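/- For $\epsilon,\epsilon'\in\mathbb R$, $\zeta\in\mathbb C$ and $\tau\in\mathbb C$ with $\operatorname{Im}\tau>0$ let $$\theta\left[{\epsilon\atop\epsilon'}\right](\zeta,\tau)=\sum_{n\in\mathbb Z}\exp\left(2\pi i\left[\tfrac12\left(n+\tfrac{\epsilon}{2}\right)^2\tau+\left(n+\tfrac{\epsilon}{2}\right)\left(\zeta+\tfrac{\epsilon'}{2}\right)\right]\right),$$ and write $\theta\left[{\epsilon\atop\epsilon'}\right]=\theta\left[{\epsilon\atop\epsilon'}\right](0,\tau)$ and $\theta'\left[{\epsilon\atop\epsilon'}\right]=\frac{\partial}{\partial\zeta}\theta\left[{\epsilon\atop\epsilon'}\right](\zeta,\tau)\big|_{\zeta=0}$; powers such as $\theta^3\left[{\epsilon\atop\epsilon'}\right]$ are powers of the theta constant. Theorem (derivative formulas of level 6). For every $\tau\in\mathbb C$ with $\operatorname{Im}\tau>0$, all theta constants occurring in the denominators below are non-zero, and $$\theta'\left[{0\atop \frac{1}{3}}\right]=\frac13\,\frac{\theta'\left[{1\atop 1}\right]\,\theta^3\left[{1\atop \frac{1}{3}}\right]}{\theta^2\left[{0\atop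 \frac{1}{3}}\right]\,\theta\left[{0\atop 1}\right]},\qquad \theta'\left[{0\atop \frac{2}{3}}\right]=\frac13\,\frac{\theta'\left[{1\atop 1}\right]\,\theta^3\left[{1\atop \frac{1}{3}}\right]}{\theta^2\left[{0\atop \frac{2}{3}}\right]\,\theta\left[{0\atop 0}\right]},$$ $$\theta'\left[{\frac{1}{3}\atop 0}\right]=-\frac13\,\frac{\theta'\left[{1\atop 1}\right]\,\theta^3\left[{\frac{1}{3}\atop 1}\right]}{\theta^2\left[{\frac{1}{3}\atop 0}\right]\,\theta\left[{1\atop 0}\right]},\qquad \theta'\left[{\frac{1}{3}\atop \frac{2}{3}}\right]=-\frac13\,\frac{\theta'\left[{1\atop 1}\right]\,\theta^3\left[{\frac{1}{3}\atop \frac{5}{3}}\right]}{\theta^2\left[{\frac{1}{3}\atop \frac{2}{3}}\right]\,\theta\left[{1\atop 0}\right]},\qquad \theta'\left[{\frac{1}{3}\atop \frac{4}{3}}\right]=\frac13\,\frac{\theta'\left[{1\atop 1}\right]\,\theta^3\left[{\frac{1}{3}\atop \frac{1}{3}}\right]}{\theta^2\left[{\frac{1}{3}\atop \frac{4}{3}}\right]\,\theta\left[{1\atop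 0}\right]},$$ $$\theta'\left[{\frac{2}{3}\atop 0}\right]=-\frac13\,\frac{\theta'\left[{1\atop 1}\right]\,\theta^3\left[{\frac{1}{3}\atop 1}\right]}{\theta^2\left[{\frac{2}{3}\atop 0}\right]\,\theta\left[{0\atop 0}\right]},\qquad \theta'\left[{\frac{2}{3}\atop 1}\right]=\frac13\,\frac{\theta'\left[{1\atop 1}\right]\,\theta^3\left[{\frac{1}{3}\atop 1}\right]}{\theta^2\left[{\frac{2}{3}\atop 1}\right]\,\theta\left[{0\atop 1}\right]},$$ $$\theta'\left[{\frac{2}{3}\atop \frac{1}{3}}\right]=-\frac13\,\frac{\theta'\left[{1\atop 1}\right]\,\theta^3\left[{\frac{1}{3}\atop \frac{5}{3}}\right]}{\theta^2\left[{\frac{2}{3}\atop \frac{1}{3}}\right]\,\theta\left[{0\atop 1}\right]},\qquad \theta'\left[{\frac{2}{3}\atop \frac{5}{3}}\right]=-\frac13\,\frac{\theta'\left[{1\atop 1}\right]\,\theta^3\left[{\frac{1}{3}\atop \frac{1}{3}}\right]}{\theta^2\left[{\frac{2}{3}\atop \frac{5}{3}}\right]\,\theta\left[{0\atop 1}\right]},$$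 $$\theta'\left[{\frac{2}{3}\atop \frac{2}{3}}\right]=\frac13\,\frac{\theta'\left[{1\atop 1}\right]\,\theta^3\left[{\frac{1}{3}\atop \frac{1}{3}}\right]}{\theta^2\left[{\frac{2}{3}\atop \frac{2}{3}}\right]\,\theta\left[{0\atop 0}\right]},\qquad \theta'\left[{\frac{2}{3}\atop \frac{4}{3}}\right]=\frac13\,\frac{\theta'\left[{1\atop 1}\right]\,\theta^3\left[{\frac{1}{3}\atop \frac{5}{3}}\right]}{\theta^2\left[{\frac{2}{3}\atop \frac{4}{3}}\right]\,\theta\left[{0\atop 0}\right]},$$ $$\theta'\left[{1\atop \frac{2}{3}}\right]=\frac13\,\frac{\theta'\left[{1\atop 1}\right]\,\theta^3\left[{1\atop \frac{1}{3}}\right]}{\theta^2\left[{1\atop \frac{2}{3}}\right]\,\theta\left[{1\atop 0}\right]}.$$ -/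

import Mathlib

/-- The `n`-th term `exp (2πi [½ (n + ε/2)² τ + (n + ε/2) (ζ + ε'/2)])` of the series of the theta
function with characteristic `[ε; ε']`. -/
noncomputable def thetaTerm (ε ε' : ℝ) (ζ τ : ℂ) (n : ℤ) : ℂ :=
  Complex.exp (2 * (Real.pi : ℂ) * Complex.I *
    (1 / 2 * ((n : ℂ) + (ε : ℂ) / 2) ^ 2 * τ
      + ((n : ℂ) + (ε : ℂ) / 2) * (ζ + (ε' : ℂ) / 2)))

/-- The theta function `θ[ε; ε'](ζ, τ)` with characteristic, in the normalization of
Farkas and Kra. -/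
noncomputable def thetaChar (ε ε' : ℝ) (ζ τ : ℂ) : ℂ :=
  ∑' n : ℤ, thetaTerm ε ε' ζ τ n

/-- The theta constant `θ[ε; ε'] = θ[ε; ε'](0, τ)`. -/
noncomputable def thetaConst (ε ε' : ℝ) (τ : ℂ) : ℂ :=
  thetaChar ε ε' 0 τ

/-- The theta derivative `θ'[ε; ε'] = ∂/∂ζ θ[ε; ε'](ζ, τ)` at `ζ = 0`. -/
noncomputable def thetaDeriv (ε ε' : ℝ) (τ : ℂ) : ℂ :=
  deriv (fun ζ : ℂ => thetaChar ε ε' ζ τ) 0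

theorem thetaTerm_eq (ε ε' : ℝ) (ζ τ : ℂ) (n : ℤ) :
    thetaTerm ε ε' ζ τ n =
      Complex.exp (2 * (Real.pi : ℂ) * Complex.I *
        (((ε : ℂ) / 2) ^ 2 * τ / 2 + (ε : ℂ) / 2 * (ζ + (ε' : ℂ) / 2))) *
      jacobiTheta₂_term n (ζ + (ε' : ℂ) / 2 + (ε : ℂ) / 2 * τ) τ := by
  unfold thetaTerm jacobiTheta₂_term
  rw [← Complex.exp_add]
  congr 1
  ring

/-- The series converges absolutely on the upper half plane. -/
theorem summable_thetaTerm (ε ε' : ℝ) (ζ : ℂ) {τ : ℂ} (hτ : 0 < τ.im) :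
    Summable (thetaTerm ε ε' ζ τ) := by
  have h := ((summable_jacobiTheta₂_term_iff
    (ζ + (ε' : ℂ) / 2 + (ε : ℂ) / 2 * τ) τ).2 hτ).mul_left
      (Complex.exp (2 * (Real.pi : ℂ) * Complex.I *
        (((ε : ℂ) / 2) ^ 2 * τ / 2 + (ε : ℂ) / 2 * (ζ + (ε' : ℂ) / 2))))
  exact h.congr fun n => (thetaTerm_eq ε ε' ζ τ n).symm

theorem thetaChar_eq (ε ε' : ℝ) (ζ τ : ℂ) :
    thetaChar ε ε' ζ τ =
      Complex.exp (2 * (Real.pi : ℂ) * Complex.I *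
        (((ε : ℂ) / 2) ^ 2 * τ / 2 + (ε : ℂ) / 2 * (ζ + (ε' : ℂ) / 2))) *
      jacobiTheta₂ (ζ + (ε' : ℂ) / 2 + (ε : ℂ) / 2 * τ) τ := by
  unfold thetaChar jacobiTheta₂
  rw [← tsum_mul_left]
  exact tsum_congr fun n => thetaTerm_eq ε ε' ζ τ n

/-- `θ[ε; ε'](·, τ)` is entire, so that `thetaDeriv` is a genuine derivative. -/
theorem differentiable_thetaChar (ε ε' : ℝ) {τ : ℂ} (hτ : 0 < τ.im) :
    Differentiable ℂ (fun ζ : ℂ => thetaChar ε ε' ζ τ) := by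
  intro ζ
  simp only [thetaChar_eq]
  refine DifferentiableAt.mul (by fun_prop) ?_
  exact (differentiableAt_jacobiTheta₂_fst _ hτ).comp ζ (by fun_prop)

open Complex MeasureTheory

/-! Each characteristic `[ε; ε']` on a left-hand side is a `3`-torsion translate of one of the even
characteristics `[0; 0]`, `[0; 1]`, `[1; 0]`: `3ε` and `3ε'` are integers, not both odd. Hence the
cube of `T(z) = θ[ε; ε'](z)` has sign multipliers, the same as `T(-z) ^ 3`, and `F(z) = T(z) ^ 3 -
T(-z) ^ 3` is an odd theta function of order three. If `[b; b']` and `[c; c']` are the other two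
even characteristics, `G = θ[1; 1] θ[b; b'] θ[c; c']` is odd with the same multipliers.

Fourier coefficients show that such odd functions form a space of dimension at most one
(`mul_eq_mul_of_odd`), so `F(x) G(y) = F(y) G(x)`. Differentiating in `x` at `0` brings in `F'(0) =
6 T(0) ^ 2 T'(0)` and `G'(0) = θ'[1; 1] θ[b; b'] θ[c; c']` (`thetaDeriv_mul_sq_mul_prod`). Then `y`
is taken to be the half period that carries `[1; 1]` to the chosen even characteristic. It swaps the
other two, so their constants cancel, while `T(y) ^ 3` and `T(-y) ^ 3` are opposite. This gives one
formula per even characteristic, and the twelve identities are specializations.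

The non-vanishing comes from the Jacobi triple product: the product and the theta series are both of
order one with equal multipliers, hence proportional, and the zeros of the product are explicit. -/

/-! ### Fourier coefficients of theta functions of order `N`. -/

/-- The integral of a `1`-periodic entire function over a unit horizontal segment does not depend
on the segment. -/
theorem integral_add_eq_of_periodic {h : ℂ → ℂ} (hd : Differentiable ℂ h)
    (hp : ∀ z, h (z + 1) = h z) (c : ℂ) :
    ∫ x in (0 : ℝ)..1, h (x + c) = ∫ x in (0 : ℝ)..1, h x := by
  -- Cauchy's theorem on the rectangle with opposite corners `0` and `1 + i Im c`; the vertical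
  -- sides cancel by periodicity. The real part of `c` is then a shift within a period.
  have key := Complex.integral_boundary_rect_eq_zero_of_differentiableOn h 0 (1 + c.im * I)
    hd.differentiableOn
  have hside : ∀ y : ℝ, h (1 + y * I) = h (y * I) := fun y => by rw [add_comm, hp]
  simp [hside] at key
  have hper : Function.Periodic (fun x : ℝ => h (x + c.im * I)) 1 := fun x => by
    have := hp (x + c.im * I)
    simp only [ofReal_add, ofReal_one]
    rw [← this]; congr 1; ring
  have h2 := hper.intervalIntegral_add_eq c.re 0
  have h3 : ∫ x in (0 : ℝ)..1, h (x + c) = ∫ x in c.re..c.re + 1, h (x + c.im * I) := by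
    have := intervalIntegral.integral_comp_add_right (a := 0) (b := 1)
      (fun x : ℝ => h (x + c.im * I)) c.re
    rw [zero_add, add_comm 1 c.re] at this
    rw [← this]
    congr 1; ext x; congr 1
    apply Complex.ext <;> simp
  rw [h3, h2, zero_add]
  exact (sub_eq_zero.1 key).symm

/-- The `n`-th Fourier coefficient of a `1`-periodic function along the unit interval. -/
noncomputable def periodCoeff (f : ℂ → ℂ) (n : ℤ) : ℂ :=
  ∫ x in (0 : ℝ)..1, exp (2 * Real.pi * I * (-n * x)) * f x

theorem exp_int_mul_add_one (n : ℤ) (z : ℂ) :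
    exp (2 * Real.pi * I * (n * (z + 1))) = exp (2 * Real.pi * I * (n * z)) := by
  rw [exp_eq_exp_iff_exists_int]
  exact ⟨n, by ring⟩

theorem periodCoeff_sub_mul {f g : ℂ → ℂ} (hf : Continuous f) (hg : Continuous g) (a b : ℂ)
    (n : ℤ) :
    periodCoeff (fun z => a * f z - b * g z) n = a * periodCoeff f n - b * periodCoeff g n := by
  unfold periodCoeff
  rw [← intervalIntegral.integral_const_mul, ← intervalIntegral.integral_const_mul,
    ← intervalIntegral.integral_sub]
  · congr 1; ext x; ring
  · exact Continuous.intervalIntegrable (by fun_prop) _ _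
  · exact Continuous.intervalIntegrable (by fun_prop) _ _

/-- The recursion for the Fourier coefficients of a theta function of order `N`. -/
theorem periodCoeff_add {f : ℂ → ℂ} (hd : Differentiable ℂ f) (hp : ∀ z, f (z + 1) = f z)
    {β τ : ℂ} {N : ℤ} (hq : ∀ z, f (z + τ) = β * exp (2 * Real.pi * I * (-N * z)) * f z) (n : ℤ) :
    β * periodCoeff f (n + N) = exp (2 * Real.pi * I * (n * τ)) * periodCoeff f n := by
  -- Moving the segment by `τ` turns the multiplier of `f` into a shift of the index by `N`.
  have h := integral_add_eq_of_periodic (h := fun z => exp (2 * Real.pi * I * (-n * z)) * f z)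
    (by fun_prop) (fun z => by
      have := exp_int_mul_add_one (-n) z
      push_cast at this
      simp only [this, hp]) τ
  unfold periodCoeff
  rw [← h, ← intervalIntegral.integral_const_mul, ← intervalIntegral.integral_const_mul]
  congr 1; ext x
  rw [hq]
  have e1 : exp (2 * Real.pi * I * (n * τ)) * (exp (2 * Real.pi * I * (-n * (x + τ))) *
      (β * exp (2 * Real.pi * I * (-N * x)) * f x)) = β * ((exp (2 * Real.pi * I * (n * τ)) *
        exp (2 * Real.pi * I * (-n * (x + τ))) * exp (2 * Real.pi * I * (-N * x))) * f x) := by ring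
  rw [e1, ← exp_add, ← exp_add]
  congr 3
  push_cast; ring

/-- A `1`-periodic entire function is determined by its Fourier coefficients. -/
theorem eq_zero_of_periodCoeff_eq_zero {f : ℂ → ℂ} (hd : Differentiable ℂ f)
    (hp : ∀ z, f (z + 1) = f z) (h0 : ∀ n, periodCoeff f n = 0) (z : ℂ) : f z = 0 := by
  have hper : Function.Periodic (fun x : ℝ => f x) 1 := fun x => by simp [hp]
  have hc : Continuous (fun x : ℝ => f x) := hd.continuous.comp continuous_ofReal
  -- On the real line `f` descends to a continuous function on the circle with zero Fourier series,
  -- so it vanishes there; the identity theorem does the rest.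
  obtain ⟨g, hgf⟩ : ∃ g : C(AddCircle (1 : ℝ), ℂ), ∀ x : ℝ, g (x : AddCircle (1 : ℝ)) = f x :=
    ⟨⟨hper.lift, continuous_coinduced_dom.mpr hc⟩, fun _ => rfl⟩
  have hg : ∀ n, fourierCoeff g n = 0 := fun n => by
    rw [fourierCoeff_eq_intervalIntegral _ n 0]
    have := h0 n
    unfold periodCoeff at this
    simp only [zero_add, div_one, one_smul]
    rw [← this]
    congr 1; ext x
    rw [hgf, fourier_coe_apply, smul_eq_mul]
    congr 2
    push_cast; ring
  have hs := hasSum_fourier_series_of_summable (f := g) (by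
    rw [show fourierCoeff g = fun _ => 0 from funext hg]; exact summable_zero)
  have hz : (fun n => fourierCoeff g n • fourier (T := 1) n) = fun _ => 0 := by
    funext n
    rw [hg, zero_smul ℂ (fourier (T := 1) n)]
  have hg0 : g = 0 := by
    rw [hz] at hs
    exact hs.unique hasSum_zero
  have hreal : ∀ x : ℝ, f x = 0 := fun x => by
    rw [← hgf, hg0, ContinuousMap.zero_apply]
  have han : AnalyticOnNhd ℂ f Set.univ := fun w _ => hd.analyticAt w
  have := han.eqOn_zero_of_preconnected_of_frequently_eq_zero isPreconnected_univ
    (Set.mem_univ (0 : ℂ)) (by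
      have h1 : ∃ᶠ x : ℝ in nhdsWithin 0 {0}ᶜ, f (x : ℂ) = 0 :=
        (Filter.Eventually.of_forall hreal).frequently
      have h2 : Filter.Tendsto (fun x : ℝ => (x : ℂ)) (nhdsWithin 0 {0}ᶜ)
          (nhdsWithin 0 {0}ᶜ) := by
        refine tendsto_nhdsWithin_iff.2 ⟨?_, ?_⟩
        · exact (continuous_ofReal.tendsto' 0 0 (by simp)).mono_left nhdsWithin_le_nhds
        · filter_upwards [self_mem_nhdsWithin] with x hx
          simpa using hx
      exact h2.frequently h1)
  exact this (Set.mem_univ z)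

/-- A theta function of order `N` is determined by `N` consecutive Fourier coefficients. -/
theorem eq_zero_of_periodCoeff_range_eq_zero {f : ℂ → ℂ} (hd : Differentiable ℂ f)
    (hp : ∀ z, f (z + 1) = f z) {β τ : ℂ} {N : ℤ} (hN : 0 < N) (hβ : β ≠ 0)
    (hq : ∀ z, f (z + τ) = β * exp (2 * Real.pi * I * (-N * z)) * f z)
    (h0 : ∀ n, 0 ≤ n → n < N → periodCoeff f n = 0) (z : ℂ) : f z = 0 := by
  refine eq_zero_of_periodCoeff_eq_zero hd hp (fun n => ?_) z
  have step : ∀ m, periodCoeff f (m + N) = 0 ↔ periodCoeff f m = 0 := fun m => by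
    have h := periodCoeff_add hd hp hq m
    constructor
    · intro hm
      rw [hm, mul_zero] at h
      exact (mul_eq_zero.1 h.symm).resolve_left (exp_ne_zero _)
    · intro hm
      rw [hm, mul_zero] at h
      exact (mul_eq_zero.1 h).resolve_left hβ
  have all : ∀ k r : ℤ, periodCoeff f r = 0 → periodCoeff f (r + N * k) = 0 := fun k r hr => by
    induction k using Int.induction_on with
    | zero => simpa using hr
    | succ i ih =>
      rw [← step] at ih
      rwa [mul_add, mul_one, ← add_assoc]
    | pred i ih =>
      rw [← step]
      convert ih using 2
      ring
  rw [← Int.emod_add_mul_ediv n N]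
  exact all _ _ (h0 _ (Int.emod_nonneg _ hN.ne') (Int.emod_lt_of_pos _ hN))

/-! ### Proportionality in order one and in odd order three. -/

/-- Theta functions of order one with the same multipliers are proportional. -/
theorem mul_eq_mul_of_order_one {f g : ℂ → ℂ} (hf : Differentiable ℂ f) (hg : Differentiable ℂ g)
    (hfp : ∀ z, f (z + 1) = f z) (hgp : ∀ z, g (z + 1) = g z) {β τ : ℂ} (hβ : β ≠ 0)
    (hfq : ∀ z, f (z + τ) = β * exp (2 * Real.pi * I * (-(1 : ℤ) * z)) * f z)
    (hgq : ∀ z, g (z + τ) = β * exp (2 * Real.pi * I * (-(1 : ℤ) * z)) * g z) (z : ℂ) :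
    periodCoeff g 0 * f z = periodCoeff f 0 * g z := by
  refine sub_eq_zero.1 (eq_zero_of_periodCoeff_range_eq_zero
    (f := fun z => periodCoeff g 0 * f z - periodCoeff f 0 * g z) (by fun_prop)
    (fun z => by rw [hfp, hgp]) one_pos hβ (fun z => by rw [hfq, hgq]; ring) (fun n h0 h1 => ?_) z)
  obtain rfl : n = 0 := by omega
  rw [periodCoeff_sub_mul hf.continuous hg.continuous]
  ring

/-- Reflection of the Fourier coefficients of a function with `f (-z) = - e(p z) f z`. -/
theorem periodCoeff_reflect {f : ℂ → ℂ} (hp : ∀ z, f (z + 1) = f z)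
    {p : ℤ} (ho : ∀ z, f (-z) = -(exp (2 * Real.pi * I * (p * z)) * f z)) (n : ℤ) :
    periodCoeff f n = -periodCoeff f (-n - p) := by
  unfold periodCoeff
  have hper : Function.Periodic
      (fun x : ℝ => exp (2 * Real.pi * I * (-n * x)) * f x) 1 := fun x => by
    have := exp_int_mul_add_one (-n) x
    push_cast at this
    simp only [ofReal_add, ofReal_one, this, hp]
  have h1 := hper.intervalIntegral_add_eq 0 (-1)
  have h2 := intervalIntegral.integral_comp_neg (a := 0) (b := 1)
    (fun x : ℝ => exp (2 * Real.pi * I * (-n * x)) * f x)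
  rw [zero_add, neg_add_cancel] at h1
  rw [neg_zero] at h2
  rw [h1, ← h2, ← intervalIntegral.integral_neg]
  congr 1; ext x
  rw [ofReal_neg, ho, mul_neg, ← mul_assoc, ← exp_add]
  congr 3
  push_cast; ring

/-- The odd theta functions of order three with the multipliers of a power of an even theta
function of characteristic `[0; *]` form a space of dimension at most one. -/
theorem mul_eq_mul_of_odd {f g : ℂ → ℂ} (hf : Differentiable ℂ f) (hg : Differentiable ℂ g)
    (hfp : ∀ z, f (z + 1) = f z) (hgp : ∀ z, g (z + 1) = g z) {β τ : ℂ} (hβ : β ≠ 0)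
    (hfq : ∀ z, f (z + τ) = β * exp (2 * Real.pi * I * (-3 * z)) * f z)
    (hgq : ∀ z, g (z + τ) = β * exp (2 * Real.pi * I * (-3 * z)) * g z) {p : ℤ}
    (hp : p = 0 ∨ p = 1 ∧ β = exp (2 * Real.pi * I * (-2 * τ)))
    (hfo : ∀ z, f (-z) = -(exp (2 * Real.pi * I * (p * z)) * f z))
    (hgo : ∀ z, g (-z) = -(exp (2 * Real.pi * I * (p * z)) * g z)) (x y : ℂ) :
    f x * g y = f y * g x := by
  -- Of the coefficients at `0`, `1`, `2`, oddness kills one and ties the other two together, so the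
  -- one at `1 - p` decides. For `p = 0` the index `0` is fixed by the reflection, and `2` is tied
  -- to `1` through `-1`.
  have main : ∀ h : ℂ → ℂ, Differentiable ℂ h → (∀ z, h (z + 1) = h z) →
      (∀ z, h (z + τ) = β * exp (2 * Real.pi * I * (-3 * z)) * h z) →
      (∀ z, h (-z) = -(exp (2 * Real.pi * I * (p * z)) * h z)) → periodCoeff h (1 - p) = 0 →
      ∀ z, h z = 0 := by
    intro h hd h1 hq ho hc
    have hq' : ∀ z, h (z + τ) = β * exp (2 * Real.pi * I * (-(3 : ℤ) * z)) * h z := by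
      simpa using hq
    refine eq_zero_of_periodCoeff_range_eq_zero hd h1 three_pos hβ hq' (fun n h0 h3 => ?_)
    have hr := periodCoeff_reflect h1 ho
    have ha := periodCoeff_add hd h1 hq'
    have two_of : periodCoeff h (-1) = 0 → periodCoeff h 2 = 0 := fun hm => by
      have := ha (-1)
      rw [hm, mul_zero] at this
      exact (mul_eq_zero.1 this).resolve_left hβ
    rcases hp with rfl | ⟨rfl, hβ'⟩
    · obtain rfl | rfl | rfl : n = 0 ∨ n = 1 ∨ n = 2 := by omega
      · have := hr 0
        simp only [neg_zero, sub_zero] at this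
        exact self_eq_neg.1 this
      · simpa using hc
      · apply two_of
        rw [hr]
        simpa using hc
    · obtain rfl | rfl | rfl : n = 0 ∨ n = 1 ∨ n = 2 := by omega
      · simpa using hc
      -- For `p = 1` the reflection sends `1` to `-2` with a minus sign, while the recursion with `β
      -- = e(-2τ)` makes these coefficients equal. This is where the value of `β` matters.
      · have e1 := hr 1
        have e2 := ha (-2)
        rw [hβ'] at e2
        push_cast at e2
        have e3 := mul_left_cancel₀ (exp_ne_zero _) e2
        norm_num at e1 e3
        rw [e3] at e1 ⊢
        exact self_eq_neg.1 e1
      · apply two_of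
        rw [hr]
        simpa using hc
  have hlin := main (fun z => periodCoeff g (1 - p) * f z - periodCoeff f (1 - p) * g z)
    (by fun_prop) (fun z => by rw [hfp, hgp]) (fun z => by rw [hfq, hgq]; ring)
    (fun z => by rw [hfo, hgo]; ring)
    (by rw [periodCoeff_sub_mul hf.continuous hg.continuous]; ring)
  by_cases hz : periodCoeff g (1 - p) = 0
  · have := main g hg hgp hgq hgo hz
    rw [this, this, mul_zero, mul_zero]
  · apply mul_left_cancel₀ hz
    have h1 := hlin x
    have h2 := hlin y
    linear_combination g y * h1 - g x * h2

/-! ### The triple product and the zeros of theta functions. -/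

/-- The product `∏ (1 + q ^ (2 n + 1) w)`, one half of the Jacobi triple product. -/
noncomputable def oddPowProd (q w : ℂ) : ℂ := ∏' n : ℕ, (1 + q ^ (2 * n + 1) * w)

theorem summable_norm_odd_pow_mul {q : ℂ} (hq : ‖q‖ < 1) (w : ℂ) :
    Summable fun n : ℕ => ‖q ^ (2 * n + 1) * w‖ := by
  have h : Summable fun n : ℕ => (‖q‖ ^ 2) ^ n * (‖q‖ * ‖w‖) :=
    (summable_geometric_of_lt_one (by positivity)
      (pow_lt_one₀ (norm_nonneg _) hq two_ne_zero)).mul_right _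
  refine h.congr fun n => ?_
  rw [norm_mul, norm_pow]; ring

/-- Splitting off the first factor is what yields the multiplier of the triple product under `z ↦ z
+ τ`, since this translation multiplies `exp (2πiz)` by `q ^ 2`. -/
theorem oddPowProd_eq_mul {q : ℂ} (hq : ‖q‖ < 1) (w : ℂ) :
    oddPowProd q w = (1 + q * w) * oddPowProd q (q ^ 2 * w) := by
  have hs : ∀ n : ℕ, 1 + q ^ (2 * (n + 1) + 1) * w = 1 + q ^ (2 * n + 1) * (q ^ 2 * w) :=
    fun n => by ring
  unfold oddPowProd
  rw [tprod_eq_zero_mul' (f := fun n : ℕ => 1 + q ^ (2 * n + 1) * w)]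
  · simp [hs]
  · simp only [hs]
    exact multipliable_one_add_of_summable (summable_norm_odd_pow_mul hq _)

theorem differentiable_oddPowProd {q : ℂ} (hq : ‖q‖ < 1) : Differentiable ℂ (oddPowProd q) := by
  intro w
  have h := Summable.hasProdLocallyUniformlyOn_nat_one_add (f := fun (n : ℕ) w => q ^ (2 * n + 1) * w)
    (K := Metric.ball (0 : ℂ) (‖w‖ + 1)) Metric.isOpen_ball
    (summable_norm_odd_pow_mul hq ((‖w‖ + 1 : ℝ) : ℂ))
    (Filter.Eventually.of_forall fun n x hx => by
      rw [norm_mul, norm_mul]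
      refine mul_le_mul_of_nonneg_left ?_ (norm_nonneg _)
      rw [norm_real, Real.norm_of_nonneg (by positivity)]
      exact (mem_ball_zero_iff.1 hx).le)
    (fun n => by fun_prop)
  refine (h.differentiableOn (.of_forall fun _ => ?_) Metric.isOpen_ball).differentiableAt
    (Metric.isOpen_ball.mem_nhds (by simp))
  simpa [Finset.prod_fn] using DifferentiableOn.finsetProd (fun _ _ => by fun_prop)

theorem oddPowProd_ne_zero {q w : ℂ} (hq : ‖q‖ < 1) (h : ∀ n : ℕ, 1 + q ^ (2 * n + 1) * w ≠ 0) :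
    oddPowProd q w ≠ 0 :=
  tprod_one_add_ne_zero_of_summable h (summable_norm_odd_pow_mul hq w)

theorem norm_exp_pi_mul_I_mul_lt_one {τ : ℂ} (hτ : 0 < τ.im) : ‖exp (Real.pi * I * τ)‖ < 1 := by
  rw [norm_exp, Real.exp_lt_one_iff]
  simp
  positivity

theorem differentiable_jacobiTheta₂_fst {τ : ℂ} (hτ : 0 < τ.im) :
    Differentiable ℂ (fun z => jacobiTheta₂ z τ) :=
  fun z => differentiableAt_jacobiTheta₂_fst z hτ

/-- Only the constant term of the series survives integration. As this coefficient is non-zero,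
every zero of theta is a zero of the product; the constant in the triple product identity is not
needed. -/
theorem periodCoeff_jacobiTheta₂_zero {τ : ℂ} (hτ : 0 < τ.im) :
    periodCoeff (fun z => jacobiTheta₂ z τ) 0 = 1 := by
  have hnorm : ∀ (n : ℤ) (x : ℝ), ‖jacobiTheta₂_term n x τ‖ = ‖jacobiTheta₂_term n 0 τ‖ := by
    intro n x
    simp [norm_jacobiTheta₂_term]
  have hs : Summable fun n : ℤ => ‖jacobiTheta₂_term n 0 τ‖ :=
    ((summable_jacobiTheta₂_term_iff 0 τ).2 hτ).norm
  have h := intervalIntegral.hasSum_integral_of_dominated_convergence (μ := volume) (a := 0) (b := 1)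
    (F := fun (n : ℤ) (x : ℝ) => jacobiTheta₂_term n x τ) (f := fun x : ℝ => jacobiTheta₂ x τ)
    (fun n _ => ‖jacobiTheta₂_term n 0 τ‖)
    (fun n => by
      refine Continuous.aestronglyMeasurable ?_
      unfold jacobiTheta₂_term
      fun_prop)
    (fun n => .of_forall fun x _ => (hnorm n x).le)
    (.of_forall fun x _ => hs)
    intervalIntegrable_const
    (.of_forall fun x _ => hasSum_jacobiTheta₂_term x hτ)
  have hterm : ∀ n : ℤ, n ≠ 0 → ∫ x in (0 : ℝ)..1, jacobiTheta₂_term n x τ = 0 := by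
    intro n hn
    have hc : 2 * Real.pi * I * n ≠ 0 := by
      simp [hn, Real.pi_ne_zero]
    have e : ∀ x : ℝ, jacobiTheta₂_term n x τ =
        exp (Real.pi * I * n ^ 2 * τ) * exp (2 * Real.pi * I * n * x) := fun x => by
      rw [jacobiTheta₂_term, ← exp_add]; ring_nf
    simp only [e]
    rw [intervalIntegral.integral_const_mul, integral_exp_mul_complex hc]
    have : exp (2 * Real.pi * I * n * (1 : ℝ)) = 1 :=
      exp_eq_one_iff.2 ⟨n, by push_cast; ring⟩
    rw [this]
    simp
  have h1 := h.unique (hasSum_single (0 : ℤ) hterm)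
  unfold periodCoeff
  simp only [Int.cast_zero, neg_zero, zero_mul, mul_zero, exp_zero, one_mul]
  rw [h1]
  simp [jacobiTheta₂_term]

/-- The zeros of the theta function are those of the factors of the Jacobi triple product. -/
theorem exists_factor_eq_zero_of_jacobiTheta₂_eq_zero {z τ : ℂ} (hτ : 0 < τ.im)
    (h : jacobiTheta₂ z τ = 0) : ∃ n : ℕ,
      1 + exp (Real.pi * I * τ) ^ (2 * n + 1) * exp (2 * Real.pi * I * z) = 0 ∨
      1 + exp (Real.pi * I * τ) ^ (2 * n + 1) * exp (-(2 * Real.pi * I * z)) = 0 := by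
  set q := exp (Real.pi * I * τ) with hqdef
  have hq : ‖q‖ < 1 := norm_exp_pi_mul_I_mul_lt_one hτ
  let P : ℂ → ℂ := fun z =>
    oddPowProd q (exp (2 * Real.pi * I * z)) * oddPowProd q (exp (-(2 * Real.pi * I * z)))
  have hP : Differentiable ℂ P :=
    ((differentiable_oddPowProd hq).comp (by fun_prop)).mul
      ((differentiable_oddPowProd hq).comp (by fun_prop))
  have hP1 : ∀ z, P (z + 1) = P z := fun z => by
    have e1 : exp (2 * Real.pi * I * (z + 1)) = exp (2 * Real.pi * I * z) := by
      rw [mul_add, mul_one, exp_add, exp_two_pi_mul_I, mul_one]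
    simp only [P, exp_neg, e1]
  have hPτ : ∀ z, P (z + τ) =
      exp (-(Real.pi * I * τ)) * exp (2 * Real.pi * I * (-(1 : ℤ) * z)) * P z := fun z => by
    have e1 : exp (2 * Real.pi * I * (z + τ)) = q ^ 2 * exp (2 * Real.pi * I * z) := by
      rw [hqdef, ← exp_nat_mul, ← exp_add]; push_cast; ring_nf
    have e2 : exp (-(2 * Real.pi * I * z)) = q ^ 2 * exp (-(2 * Real.pi * I * (z + τ))) := by
      rw [hqdef, ← exp_nat_mul, ← exp_add]; push_cast; ring_nf
    have e3 : q * exp (-(2 * Real.pi * I * (z + τ))) =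
        exp (-(Real.pi * I * τ)) * exp (2 * Real.pi * I * (-(1 : ℤ) * z)) := by
      rw [hqdef, ← exp_add, ← exp_add]; push_cast; ring_nf
    have e4 : exp (-(Real.pi * I * τ)) * exp (2 * Real.pi * I * (-(1 : ℤ) * z)) *
        (q * exp (2 * Real.pi * I * z)) = 1 := by
      rw [hqdef, ← exp_add, ← exp_add, ← exp_add, exp_eq_one_iff]
      exact ⟨0, by push_cast; ring⟩
    -- With `w = exp (2πiz)`, one half loses the factor `1 + q w` and the other gains `1 + (q w)⁻¹`;
    -- their quotient `(q w)⁻¹` is the multiplier.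
    simp only [P]
    rw [e1, oddPowProd_eq_mul hq (exp (-(2 * Real.pi * I * (z + τ)))), ← e2,
      oddPowProd_eq_mul hq (exp (2 * Real.pi * I * z)), e3]
    linear_combination (-oddPowProd q (q ^ 2 * exp (2 * Real.pi * I * z)) *
      oddPowProd q (exp (-(2 * Real.pi * I * z)))) * e4
  have hΘτ : ∀ z, jacobiTheta₂ (z + τ) τ = exp (-(Real.pi * I * τ)) *
      exp (2 * Real.pi * I * (-(1 : ℤ) * z)) * jacobiTheta₂ z τ := fun z => by
    rw [jacobiTheta₂_add_left', ← exp_add]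
    congr 2
    push_cast; ring
  have prop := mul_eq_mul_of_order_one hP (differentiable_jacobiTheta₂_fst hτ) hP1
    (fun z => jacobiTheta₂_add_left z τ) (exp_ne_zero _) hPτ hΘτ
  rw [periodCoeff_jacobiTheta₂_zero hτ] at prop
  have hPz : P z = 0 := by
    have := prop z
    rwa [one_mul, h, mul_zero] at this
  by_contra! hne
  exact mul_ne_zero (oddPowProd_ne_zero hq fun n => (hne n).1)
    (oddPowProd_ne_zero hq fun n => (hne n).2) hPz

/-- A theta constant with characteristic that is not a pair of odd integers is non-zero. -/
theorem thetaConst_ne_zero {ε ε' : ℝ} {τ : ℂ} (hτ : 0 < τ.im)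
    (h : ∀ m n : ℤ, ε = 2 * m + 1 → ε' ≠ 2 * n + 1) : thetaConst ε ε' τ ≠ 0 := by
  intro h0
  rw [thetaConst, thetaChar_eq] at h0
  obtain ⟨n, hn⟩ := exists_factor_eq_zero_of_jacobiTheta₂_eq_zero hτ
    ((mul_eq_zero.1 h0).resolve_left (exp_ne_zero _))
  have key : ∀ s : ℤ, s = 1 ∨ s = -1 → 1 + exp (Real.pi * I * τ) ^ (2 * n + 1) *
      exp (s * (2 * Real.pi * I * (0 + (ε' : ℂ) / 2 + ε / 2 * τ))) ≠ 0 := by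
    intro s hs hz
    have hexp : exp (Real.pi * I * τ) ^ (2 * n + 1) *
        exp (s * (2 * Real.pi * I * (0 + (ε' : ℂ) / 2 + ε / 2 * τ))) = exp (Real.pi * I) := by
      rw [exp_pi_mul_I]; linear_combination hz
    rw [← exp_nat_mul, ← exp_add, exp_eq_exp_iff_exists_int] at hexp
    obtain ⟨k, hk⟩ := hexp
    have hpi : (Real.pi * I : ℂ) ≠ 0 := by simp [Real.pi_ne_zero]
    have hk' : ((2 * n + 1 + s * ε : ℝ) : ℂ) * τ + ((s * ε' : ℝ) : ℂ) = ((1 + 2 * k : ℝ) : ℂ) := by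
      apply mul_left_cancel₀ hpi
      push_cast at hk ⊢
      linear_combination hk
    -- As `Im τ > 0`, the imaginary part forces `s ε = -(2n + 1)`, and what remains gives `s ε' = 2k
    -- + 1`: both entries are odd.
    have him := congrArg Complex.im hk'
    rw [add_im, im_ofReal_mul, ofReal_im, ofReal_im, add_zero] at him
    have hε := (mul_eq_zero.1 him).resolve_right hτ.ne'
    rw [hε, ofReal_zero, zero_mul, zero_add, ofReal_inj] at hk'
    rcases hs with rfl | rfl
    · refine h (-n - 1) k ?_ ?_
      · push_cast at hε ⊢; linarith
      · push_cast at hk' ⊢; linarith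
    · refine h n (-k - 1) ?_ ?_
      · push_cast at hε ⊢; linarith
      · push_cast at hk' ⊢; linarith
  rcases hn with hn | hn
  · exact key 1 (.inl rfl) (by rw [Int.cast_one, one_mul]; exact hn)
  · exact key (-1) (.inr rfl) (by rw [Int.cast_neg, Int.cast_one, neg_one_mul]; exact hn)

/-! ### Translation by half periods, multipliers and parity. -/

/-- Half periods act on characteristics by addition. The cases `(0, 2)` and `(2, 0)`, reduced modulo
`2`, give the multipliers under `1` and `τ`; `z = 0` gives the values at half periods. -/
theorem thetaChar_add_half (ε ε' a b : ℝ) (z τ : ℂ) :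
    thetaChar ε ε' (z + (a * τ + b) / 2) τ =
      exp (-(Real.pi * I * (a ^ 2 * τ / 4 + a * z + a * (ε' + b) / 2))) *
        thetaChar (ε + a) (ε' + b) z τ := by
  rw [thetaChar_eq, thetaChar_eq, ← mul_assoc, ← exp_add]
  push_cast
  congr 2 <;> ring

theorem thetaChar_add_two_left (ε ε' : ℝ) (z τ : ℂ) :
    thetaChar (ε + 2) ε' z τ = thetaChar ε ε' z τ := by
  unfold thetaChar
  rw [← (Equiv.addRight (1 : ℤ)).tsum_eq (thetaTerm ε ε' z τ)]
  refine tsum_congr fun n => ?_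
  simp only [thetaTerm, Equiv.coe_addRight]
  push_cast
  ring_nf

theorem thetaChar_add_two_right (ε ε' : ℝ) (z τ : ℂ) :
    thetaChar ε (ε' + 2) z τ = exp (Real.pi * I * ε) * thetaChar ε ε' z τ := by
  unfold thetaChar
  rw [← tsum_mul_left]
  refine tsum_congr fun n => ?_
  simp only [thetaTerm]
  rw [← exp_add, exp_eq_exp_iff_exists_int]
  exact ⟨n, by push_cast; ring⟩

theorem thetaChar_neg (ε ε' : ℝ) (z τ : ℂ) :
    thetaChar ε ε' (-z) τ = thetaChar (-ε) (-ε') z τ := by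
  rw [thetaChar_eq, thetaChar_eq, ← jacobiTheta₂_neg_left]
  push_cast
  congr 2 <;> ring

theorem thetaChar_add_one (ε ε' : ℝ) (z τ : ℂ) :
    thetaChar ε ε' (z + 1) τ = exp (Real.pi * I * ε) * thetaChar ε ε' z τ := by
  have h := thetaChar_add_half ε ε' 0 2 z τ
  rw [add_zero, thetaChar_add_two_right] at h
  simpa using h

theorem thetaChar_add_tau (ε ε' : ℝ) (z τ : ℂ) :
    thetaChar ε ε' (z + τ) τ =
      exp (-(Real.pi * I * (τ + 2 * z + ε'))) * thetaChar ε ε' z τ := by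
  have h := thetaChar_add_half ε ε' 2 0 z τ
  rw [add_zero, thetaChar_add_two_left] at h
  have e : z + ((2 : ℝ) * τ + (0 : ℝ)) / 2 = z + τ := by push_cast; ring
  rw [e] at h
  rw [h]
  congr 2
  push_cast; ring

theorem thetaChar_zero_zero_neg (z τ : ℂ) : thetaChar 0 0 (-z) τ = thetaChar 0 0 z τ := by
  rw [thetaChar_neg, neg_zero]

theorem thetaChar_zero_one_neg (z τ : ℂ) : thetaChar 0 1 (-z) τ = thetaChar 0 1 z τ := by
  have h := thetaChar_add_two_right 0 (-1) z τ
  rw [thetaChar_neg, neg_zero]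
  norm_num at h
  exact h.symm

theorem thetaChar_one_zero_neg (z τ : ℂ) : thetaChar 1 0 (-z) τ = thetaChar 1 0 z τ := by
  have h := thetaChar_add_two_left (-1) 0 z τ
  rw [thetaChar_neg, neg_zero]
  norm_num at h
  exact h.symm

theorem thetaChar_one_one_neg (z τ : ℂ) : thetaChar 1 1 (-z) τ = -thetaChar 1 1 z τ := by
  have h := thetaChar_add_two_right 1 (-1) z τ
  have h' := thetaChar_add_two_left (-1) (-1) z τ
  norm_num at h h'
  rw [thetaChar_neg, ← h', h, neg_neg]

/-! ### The odd part of the cube and its derivative at the origin. -/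

/-- Odd entire functions with the multipliers of the cube of an even theta function are
proportional. -/
theorem mul_eq_mul_of_odd_of_multipliers {F G : ℂ → ℂ} (hF : Differentiable ℂ F)
    (hG : Differentiable ℂ G) {τ ρ : ℂ} {p : ℤ} (hp : p = 0 ∨ p = 1 ∧ ρ = 1) (hρ : ρ ≠ 0)
    (hF1 : ∀ z, F (z + 1) = exp (Real.pi * I * p) * F z)
    (hG1 : ∀ z, G (z + 1) = exp (Real.pi * I * p) * G z)
    (hFτ : ∀ z, F (z + τ) = ρ * exp (-(Real.pi * I * (3 * τ + 6 * z))) * F z)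
    (hGτ : ∀ z, G (z + τ) = ρ * exp (-(Real.pi * I * (3 * τ + 6 * z))) * G z)
    (hFo : ∀ z, F (-z) = -F z) (hGo : ∀ z, G (-z) = -G z) (x y : ℂ) :
    F x * G y = F y * G x := by
  have h1 : ∀ H : ℂ → ℂ, (∀ z, H (z + 1) = exp (Real.pi * I * p) * H z) → ∀ z,
      exp (-(Real.pi * I * p * (z + 1))) * H (z + 1) = exp (-(Real.pi * I * p * z)) * H z := by
    intro H hH z
    rw [hH, ← mul_assoc, ← exp_add]
    ring_nf
  have hτ : ∀ H : ℂ → ℂ, (∀ z, H (z + τ) = ρ * exp (-(Real.pi * I * (3 * τ + 6 * z))) * H z) →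
      ∀ z, exp (-(Real.pi * I * p * (z + τ))) * H (z + τ) =
        (ρ * exp (-(Real.pi * I * ((3 + p) * τ)))) * exp (2 * Real.pi * I * (-3 * z)) *
          (exp (-(Real.pi * I * p * z)) * H z) := by
    intro H hH z
    have e : exp (-(Real.pi * I * p * (z + τ))) * exp (-(Real.pi * I * (3 * τ + 6 * z))) =
        exp (-(Real.pi * I * ((3 + p) * τ))) * exp (2 * Real.pi * I * (-3 * z)) *
          exp (-(Real.pi * I * p * z)) := by
      rw [← exp_add, ← exp_add, ← exp_add]
      ring_nf
    rw [hH]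
    linear_combination (ρ * H z) * e
  have ho : ∀ H : ℂ → ℂ, (∀ z, H (-z) = -H z) → ∀ z, exp (-(Real.pi * I * p * -z)) * H (-z) =
      -(exp (2 * Real.pi * I * (p * z)) * (exp (-(Real.pi * I * p * z)) * H z)) := by
    intro H hH z
    rw [hH, ← mul_assoc, ← exp_add]
    ring_nf
  -- The factor `exp (-πipz)` makes both functions `1`-periodic, at the price of the twist `exp
  -- (2πipz)` in the oddness relation.
  have key := mul_eq_mul_of_odd (f := fun z => exp (-(Real.pi * I * p * z)) * F z)
    (g := fun z => exp (-(Real.pi * I * p * z)) * G z) (by fun_prop) (by fun_prop)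
    (h1 F hF1) (h1 G hG1) (mul_ne_zero hρ (exp_ne_zero _)) (hτ F hFτ) (hτ G hGτ) (p := p)
    (hp.imp_right fun h => ⟨h.1, by rw [h.1, h.2, one_mul]; congr 1; push_cast; ring⟩)
    (ho F hFo) (ho G hGo) x y
  refine mul_left_cancel₀ (mul_ne_zero (exp_ne_zero (-(Real.pi * I * p * x)))
    (exp_ne_zero (-(Real.pi * I * p * y)))) ?_
  linear_combination key

/-- The odd part of the cube of a theta function is proportional to a product of three theta
functions, the derivative being taken at the origin. -/
theorem thetaDeriv_mul_sq_mul_prod {τ : ℂ} (hτ : 0 < τ.im) {ε ε' b b' c c' : ℝ} {p : ℤ} {ρ : ℂ}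
    (hp : p = 0 ∨ p = 1 ∧ ρ = 1)
    (hε : exp (Real.pi * I * (3 * ε)) = exp (Real.pi * I * p))
    (hε' : exp (-(Real.pi * I * (3 * ε'))) = ρ) (hρ : ρ * ρ = 1)
    (hbc : exp (Real.pi * I * (1 + b + c)) = exp (Real.pi * I * p))
    (hbc' : exp (-(Real.pi * I * (1 + b' + c'))) = ρ)
    (hb : ∀ z, thetaChar b b' (-z) τ = thetaChar b b' z τ)
    (hc : ∀ z, thetaChar c c' (-z) τ = thetaChar c c' z τ) (y : ℂ) :
    6 * thetaConst ε ε' τ ^ 2 * thetaDeriv ε ε' τ *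
        (thetaChar 1 1 y τ * thetaChar b b' y τ * thetaChar c c' y τ) =
      (thetaChar ε ε' y τ ^ 3 - thetaChar ε ε' (-y) τ ^ 3) *
        (thetaDeriv 1 1 τ * thetaConst b b' τ * thetaConst c c' τ) := by
  have hd := fun ε ε' => differentiable_thetaChar ε ε' hτ
  set T : ℂ → ℂ := fun z => thetaChar ε ε' z τ with hT
  set A : ℂ → ℂ := fun z => thetaChar 1 1 z τ with hA
  set B : ℂ → ℂ := fun z => thetaChar b b' z τ with hB
  set C : ℂ → ℂ := fun z => thetaChar c c' z τ with hC
  have dT : Differentiable ℂ T := hd _ _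
  have dA : Differentiable ℂ A := hd _ _
  have dB : Differentiable ℂ B := hd _ _
  have dC : Differentiable ℂ C := hd _ _
  -- The multiplier of `T ^ 3` under `1` is a sign, as `ρ` is, hence equal to its inverse; so `T(-z)
  -- ^ 3` has the same multipliers as `T(z) ^ 3`.
  have hpp : exp (Real.pi * I * p) * exp (Real.pi * I * p) = 1 := by
    rw [← exp_add, exp_eq_one_iff]
    exact ⟨p, by ring⟩
  have hT1 : ∀ z, T (z + 1) ^ 3 = exp (Real.pi * I * p) * T z ^ 3 := fun z => by
    simp only [hT]
    rw [thetaChar_add_one, mul_pow, ← exp_nat_mul, ← hε]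
    congr 2
    push_cast; ring
  have hTτ : ∀ z, T (z + τ) ^ 3 = ρ * exp (-(Real.pi * I * (3 * τ + 6 * z))) * T z ^ 3 :=
    fun z => by
    simp only [hT]
    rw [thetaChar_add_tau, mul_pow, ← exp_nat_mul, ← hε', ← exp_add]
    congr 2
    push_cast; ring
  have key := mul_eq_mul_of_odd_of_multipliers (F := fun z => T z ^ 3 - T (-z) ^ 3)
    (G := fun z => A z * B z * C z) (τ := τ) (p := p) (ρ := ρ)
    (by fun_prop) (by fun_prop) hp (left_ne_zero_of_mul_eq_one hρ)
    (fun z => by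
      have h := hT1 (-(z + 1))
      rw [neg_add, neg_add_cancel_right] at h
      rw [hT1, neg_add, h]
      linear_combination T (-z + -1) ^ 3 * hpp)
    (fun z => by
      simp only [hA, hB, hC]
      rw [thetaChar_add_one, thetaChar_add_one, thetaChar_add_one, ← hbc, mul_add, mul_add,
        exp_add, exp_add]
      push_cast; ring)
    (fun z => by
      have h := hTτ (-(z + τ))
      rw [neg_add, neg_add_cancel_right] at h
      rw [hTτ, neg_add, h]
      have e : exp (-(Real.pi * I * (3 * τ + 6 * z))) *
          exp (-(Real.pi * I * (3 * τ + 6 * (-z + -τ)))) = 1 := by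
        rw [← exp_add, exp_eq_one_iff]
        exact ⟨0, by push_cast; ring⟩
      linear_combination (T (-z + -τ) ^ 3 * ρ * ρ) * e + T (-z + -τ) ^ 3 * hρ)
    (fun z => by
      simp only [hA, hB, hC]
      have e : exp (-(Real.pi * I * (τ + 2 * z + (1 : ℝ)))) *
          exp (-(Real.pi * I * (τ + 2 * z + b'))) * exp (-(Real.pi * I * (τ + 2 * z + c'))) =
          ρ * exp (-(Real.pi * I * (3 * τ + 6 * z))) := by
        rw [← hbc', ← exp_add, ← exp_add, ← exp_add]
        congr 1
        push_cast; ring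
      rw [thetaChar_add_tau, thetaChar_add_tau, thetaChar_add_tau, ← e]
      ring)
    (fun z => by rw [neg_neg]; ring)
    (fun z => by
      have hA' : A (-z) = -A z := thetaChar_one_one_neg z τ
      have hB' : B (-z) = B z := hb z
      have hC' : C (-z) = C z := hc z
      rw [hA', hB', hC']; ring)
  have hA0 : A 0 = 0 := by
    have := thetaChar_one_one_neg 0 τ
    rw [neg_zero] at this
    exact self_eq_neg.1 this
  have dTn : HasDerivAt (fun z => T (-z)) (-deriv T 0) 0 := by
    have h0 : HasDerivAt T (deriv T 0) (-0) := by
      rw [neg_zero]; exact dT.differentiableAt.hasDerivAt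
    simpa [Function.comp_def] using h0.comp (0 : ℂ) (hasDerivAt_neg (0 : ℂ))
  -- Both sides of `key` are differentiated in `x` at `0`; as `A 0 = 0`, only the term with `A'(0)`
  -- survives on the right.
  have h1 := (((dT 0).hasDerivAt.pow 3).sub (dTn.pow 3)).mul_const (A y * B y * C y)
  have h2 := ((((dA 0).hasDerivAt.mul (dB 0).hasDerivAt).mul (dC 0).hasDerivAt).const_mul
    (T y ^ 3 - T (-y) ^ 3))
  have h3 := h1.unique (h2.congr_of_eventuallyEq (.of_forall fun x => by
    simpa using key x y))
  simp only [Pi.mul_apply, hA0, neg_zero] at h3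
  change 6 * T 0 ^ 2 * deriv T 0 * (A y * B y * C y) =
    (T y ^ 3 - T (-y) ^ 3) * (deriv A 0 * B 0 * C 0)
  norm_num at h3
  linear_combination h3

/-! ### Theta constants at half periods and signs of cubes. -/

theorem exp_pi_mul_I_mul_int (k : ℤ) : exp (Real.pi * I * k) = (-1) ^ k := by
  rw [mul_comm, exp_int_mul, exp_pi_mul_I]

theorem thetaConst_zero_zero_ne_zero {τ : ℂ} (hτ : 0 < τ.im) : thetaConst 0 0 τ ≠ 0 :=
  thetaConst_ne_zero hτ fun m n h _ => by
    have : (0 : ℤ) = 2 * m + 1 := by exact_mod_cast h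
    omega

theorem thetaConst_zero_one_ne_zero {τ : ℂ} (hτ : 0 < τ.im) : thetaConst 0 1 τ ≠ 0 :=
  thetaConst_ne_zero hτ fun m n h _ => by
    have : (0 : ℤ) = 2 * m + 1 := by exact_mod_cast h
    omega

theorem thetaConst_one_zero_ne_zero {τ : ℂ} (hτ : 0 < τ.im) : thetaConst 1 0 τ ≠ 0 :=
  thetaConst_ne_zero hτ fun m n _ h => by
    have : (0 : ℤ) = 2 * n + 1 := by exact_mod_cast h
    omega

/-- The value of a theta function at a half period. -/
theorem thetaChar_half (ε ε' a b : ℝ) (τ : ℂ) :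
    thetaChar ε ε' ((a * τ + b) / 2) τ =
      exp (-(Real.pi * I * (a ^ 2 * τ / 4))) * exp (-(Real.pi * I * (a * (ε' + b) / 2))) *
        thetaConst (ε + a) (ε' + b) τ := by
  have h := thetaChar_add_half ε ε' a b 0 τ
  rw [zero_add] at h
  rw [h, thetaConst, ← exp_add]
  congr 2
  ring

theorem thetaConst_add_two_left (ε ε' : ℝ) (τ : ℂ) :
    thetaConst (ε + 2) ε' τ = thetaConst ε ε' τ :=
  thetaChar_add_two_left ε ε' 0 τ

theorem thetaConst_add_two_right (ε ε' : ℝ) (τ : ℂ) :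
    thetaConst ε (ε' + 2) τ = exp (Real.pi * I * ε) * thetaConst ε ε' τ :=
  thetaChar_add_two_right ε ε' 0 τ

theorem thetaConst_neg (ε ε' : ℝ) (τ : ℂ) : thetaConst (-ε) (-ε') τ = thetaConst ε ε' τ := by
  rw [thetaConst, thetaConst, ← thetaChar_neg, neg_zero]

theorem thetaConst_two_sub_neg (ε ε' : ℝ) (τ : ℂ) :
    thetaConst (2 - ε) (-ε') τ = thetaConst ε ε' τ := by
  rw [← thetaConst_neg ε, ← thetaConst_add_two_left (-ε)]
  congr 1; ring

/-- Cubing turns the cube root of `±1` in `thetaConst_add_two_right` into a sign. -/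
theorem thetaConst_add_two_right_pow_three {ε : ℝ} {k : ℤ} (hk : 3 * ε = k) (ε' : ℝ) (τ : ℂ) :
    thetaConst ε (ε' + 2) τ ^ 3 = (-1) ^ k * thetaConst ε ε' τ ^ 3 := by
  rw [thetaConst_add_two_right, mul_pow, ← exp_nat_mul, ← exp_pi_mul_I_mul_int]
  congr 2
  have : (3 * ε : ℂ) = k := by exact_mod_cast hk
  rw [← this]; push_cast; ring

theorem exp_half_int (k : ℤ) : exp (-(Real.pi * I * ((2 * k + 1 : ℤ) / 2))) = -I * (-1) ^ k := by
  have e : -((Real.pi : ℂ) * I * ((2 * k + 1 : ℤ) / 2)) =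
      -(Real.pi / 2 * I) + Real.pi * I * (-k : ℤ) := by push_cast; ring
  rw [e, exp_add, exp_neg, exp_pi_div_two_mul_I, inv_I, exp_pi_mul_I_mul_int, zpow_neg,
    ← inv_zpow, inv_neg_one]

theorem neg_one_zpow_neg (k : ℤ) : (-1 : ℂ) ^ (-k) = (-1) ^ k := by
  rw [zpow_neg, ← inv_zpow, inv_neg_one]

theorem neg_one_zpow_add_one (k : ℤ) : (-1 : ℂ) ^ (k + 1) = -(-1) ^ k := by
  rw [zpow_add_one₀ (neg_ne_zero.2 one_ne_zero), mul_neg_one]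

theorem neg_one_zpow_two_mul_add_one (k : ℤ) : (-1 : ℂ) ^ (2 * k + 1) = -1 := by
  rw [neg_one_zpow_add_one, zpow_mul]
  norm_num

/-- The cube of a theta function at a half period. -/
theorem thetaChar_half_pow_three {ε' a b : ℝ} {k : ℤ} (hk : 3 * (a * (ε' + b)) = (2 * k + 1 : ℤ))
    (ε : ℝ) (τ : ℂ) :
    thetaChar ε ε' ((a * τ + b) / 2) τ ^ 3 = exp (-(Real.pi * I * (a ^ 2 * τ / 4))) ^ 3 *
      (-I * (-1) ^ k) * thetaConst (ε + a) (ε' + b) τ ^ 3 := by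
  have hk' : (3 * (a * (ε' + b)) : ℂ) = (2 * k + 1 : ℤ) := by exact_mod_cast hk
  rw [thetaChar_half, mul_pow, mul_pow, ← exp_half_int, ← hk',
    ← exp_nat_mul (-(Real.pi * I * (a * (ε' + b) / 2)))]
  congr 3
  push_cast; ring

/-! ### One derivative formula for each even characteristic. -/

/-- The derivative formula at a `3`-torsion translate of the even characteristic `[0; 1]`. -/
theorem thetaDeriv_formula_zero_one {τ : ℂ} (hτ : 0 < τ.im) {ε ε' : ℝ} {k l : ℤ}
    (hk : 3 * ε = (2 * k : ℤ)) (hl : 3 * ε' = (2 * l + 1 : ℤ)) :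
    3 * thetaConst ε ε' τ ^ 2 * thetaDeriv ε ε' τ * thetaConst 0 1 τ =
      (-1) ^ l * thetaConst (ε + 1) ε' τ ^ 3 * thetaDeriv 1 1 τ := by
  have hk' : (3 * ε : ℂ) = (2 * k : ℤ) := by exact_mod_cast hk
  have hl' : (3 * ε' : ℂ) = (2 * l + 1 : ℤ) := by exact_mod_cast hl
  have key := thetaDeriv_mul_sq_mul_prod hτ (ε := ε) (ε' := ε') (b := 0) (b' := 0) (c := 1)
    (c' := 0) (p := 0) (ρ := -1) (.inl rfl)
    (by rw [hk', exp_pi_mul_I_mul_int, exp_pi_mul_I_mul_int, zpow_mul]; norm_num)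
    (by rw [hl', exp_neg, exp_pi_mul_I_mul_int, neg_one_zpow_two_mul_add_one]; norm_num)
    (by norm_num)
    (by
      have := exp_pi_mul_I_mul_int 2
      norm_num at this ⊢
      exact this)
    (by simp [exp_neg])
    (fun z => thetaChar_zero_zero_neg z τ) (fun z => thetaChar_one_zero_neg z τ) (τ / 2)
  -- At `y = τ / 2` the characteristics `[1; 1]`, `[0; 0]`, `[1; 0]` become `[0; 1]`, `[1; 0]`, `[0;
  -- 0]` modulo `2`, so the last two constants cancel.
  have hy : τ / 2 = (((1 : ℝ) : ℂ) * τ + (0 : ℝ)) / 2 := by push_cast; ring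
  have hy' : -(τ / 2) = (((-1 : ℝ) : ℂ) * τ + (0 : ℝ)) / 2 := by push_cast; ring
  have t1 := thetaChar_half_pow_three (ε' := ε') (a := 1) (b := 0) (k := l)
    (by rw [← hl]; ring) ε τ
  -- The index `-(l + 1)` gives the sign opposite to that of `t1`: the difference of cubes doubles,
  -- and `6` becomes `3`.
  have t2 := thetaChar_half_pow_three (ε' := ε') (a := -1) (b := 0) (k := -(l + 1))
    (by push_cast at hl ⊢; linarith) ε τ
  rw [← thetaConst_add_two_left (ε + -1), neg_one_zpow_neg, neg_one_zpow_add_one] at t2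
  have g1 := thetaChar_half 1 1 1 0 τ
  have g2 := thetaChar_half 0 0 1 0 τ
  have g3 := thetaChar_half 1 0 1 0 τ
  have e1 := exp_half_int 0
  have c1 := thetaConst_add_two_left 0 1 τ
  have c2 := thetaConst_add_two_left 0 0 τ
  rw [← hy] at t1 g1 g2 g3
  rw [← hy', show ε + -1 + 2 = ε + 1 by ring] at t2
  norm_num at t1 t2 g1 g2 g3 e1 c1 c2
  rw [t1, t2, g1, g2, g3, e1, c1, c2] at key
  refine mul_left_cancel₀ (mul_ne_zero (mul_ne_zero (mul_ne_zero I_ne_zero (pow_ne_zero 3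
    (exp_ne_zero (-(Real.pi * I * (τ / 4))))))
    (thetaConst_zero_zero_ne_zero hτ)) (thetaConst_one_zero_ne_zero hτ)) ?_
  linear_combination (-1 / 2) * key

/-- The derivative formula at a `3`-torsion translate of the even characteristic `[0; 0]`. -/
theorem thetaDeriv_formula_zero_zero {τ : ℂ} (hτ : 0 < τ.im) {ε ε' : ℝ} {k l : ℤ}
    (hk : 3 * ε = (2 * k : ℤ)) (hl : 3 * ε' = (2 * l : ℤ)) :
    3 * thetaConst ε ε' τ ^ 2 * thetaDeriv ε ε' τ * thetaConst 0 0 τ =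
      (-1) ^ l * thetaConst (ε + 1) (ε' + 1) τ ^ 3 * thetaDeriv 1 1 τ := by
  have hk' : (3 * ε : ℂ) = (2 * k : ℤ) := by exact_mod_cast hk
  have hl' : (3 * ε' : ℂ) = (2 * l : ℤ) := by exact_mod_cast hl
  have e2 := exp_pi_mul_I_mul_int 2
  have key := thetaDeriv_mul_sq_mul_prod hτ (ε := ε) (ε' := ε') (b := 0) (b' := 1) (c := 1)
    (c' := 0) (p := 0) (ρ := 1) (.inl rfl)
    (by rw [hk', exp_pi_mul_I_mul_int, exp_pi_mul_I_mul_int, zpow_mul]; norm_num)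
    (by rw [hl', exp_neg, exp_pi_mul_I_mul_int, zpow_mul]; norm_num)
    (by norm_num)
    (by
      norm_num at e2 ⊢
      exact e2)
    (by
      norm_num [exp_neg] at e2 ⊢
      exact e2)
    (fun z => thetaChar_zero_one_neg z τ) (fun z => thetaChar_one_zero_neg z τ) ((τ + 1) / 2)
  -- Here `[1; 1]`, `[0; 1]`, `[1; 0]` become `[0; 0]`, `[1; 0]`, `[0; 1]` modulo `2`.
  have hy : (τ + 1) / 2 = (((1 : ℝ) : ℂ) * τ + (1 : ℝ)) / 2 := by push_cast; ring
  have hy' : -((τ + 1) / 2) = (((-1 : ℝ) : ℂ) * τ + (-1 : ℝ)) / 2 := by push_cast; ring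
  have t1 := thetaChar_half_pow_three (ε' := ε') (a := 1) (b := 1) (k := l + 1)
    (by push_cast at hl ⊢; linarith) ε τ
  have t2 := thetaChar_half_pow_three (ε' := ε') (a := -1) (b := -1) (k := -l + 1)
    (by push_cast at hl ⊢; linarith) ε τ
  -- The signs in `t1` and `t2` agree; the opposite sign comes from this shift, because `3(ε + 1)`
  -- is odd.
  have t3 := thetaConst_add_two_right_pow_three (ε := ε + 1) (k := 2 * (k + 1) + 1)
    (by push_cast at hk ⊢; linarith) (ε' + -1) τ
  rw [neg_one_zpow_add_one] at t1
  rw [← thetaConst_add_two_left (ε + -1), neg_one_zpow_add_one, neg_one_zpow_neg] at t2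
  rw [neg_one_zpow_two_mul_add_one] at t3
  have g1 := thetaChar_half 1 1 1 1 τ
  have g2 := thetaChar_half 0 1 1 1 τ
  have g3 := thetaChar_half 1 0 1 1 τ
  have e1 := exp_half_int 0
  have c1 := thetaConst_add_two_left 0 2 τ
  have c2 := thetaConst_add_two_left 0 1 τ
  have c3 := thetaConst_add_two_right 0 0 τ
  have c4 := thetaConst_add_two_right 1 0 τ
  rw [← hy] at t1 g1 g2 g3
  rw [← hy', show ε + -1 + 2 = ε + 1 by ring] at t2
  rw [show ε' + -1 + 2 = ε' + 1 by ring] at t3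
  norm_num [exp_neg] at t1 t2 t3 g1 g2 g3 e1 c1 c2 c3 c4
  rw [c1, c3] at g1
  rw [c4] at g2
  rw [c2, e1] at g3
  rw [t1, t2, t3, g1, g2, g3] at key
  rw [t3]
  refine mul_left_cancel₀ (mul_ne_zero (mul_ne_zero (mul_ne_zero I_ne_zero (pow_ne_zero 3
    (inv_ne_zero (exp_ne_zero (Real.pi * I * (τ / 4))))))
    (thetaConst_zero_one_ne_zero hτ)) (thetaConst_one_zero_ne_zero hτ)) ?_
  linear_combination (1 / 2) * key

/-- The derivative formula at a `3`-torsion translate of the even characteristic `[1; 0]`. -/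
theorem thetaDeriv_formula_one_zero {τ : ℂ} (hτ : 0 < τ.im) {ε ε' : ℝ} {k l : ℤ}
    (hk : 3 * ε = (2 * k + 1 : ℤ)) (hl : 3 * ε' = (2 * l : ℤ)) :
    3 * thetaConst ε ε' τ ^ 2 * thetaDeriv ε ε' τ * thetaConst 1 0 τ =
      -(thetaConst ε (ε' + 1) τ ^ 3 * thetaDeriv 1 1 τ) := by
  have hk' : (3 * ε : ℂ) = (2 * k + 1 : ℤ) := by exact_mod_cast hk
  have hl' : (3 * ε' : ℂ) = (2 * l : ℤ) := by exact_mod_cast hl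
  have key := thetaDeriv_mul_sq_mul_prod hτ (ε := ε) (ε' := ε') (b := 0) (b' := 0) (c := 0)
    (c' := 1) (p := 1) (ρ := 1) (.inr ⟨rfl, rfl⟩)
    (by rw [hk', exp_pi_mul_I_mul_int, exp_pi_mul_I_mul_int, neg_one_zpow_two_mul_add_one]
        norm_num)
    (by rw [hl', exp_neg, exp_pi_mul_I_mul_int, zpow_mul]; norm_num)
    (by norm_num)
    (by norm_num)
    (by
      have := exp_pi_mul_I_mul_int 2
      norm_num [exp_neg] at this ⊢
      exact this)
    (fun z => thetaChar_zero_zero_neg z τ) (fun z => thetaChar_zero_one_neg z τ) (1 / 2)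
  -- Here `[1; 1]`, `[0; 0]`, `[0; 1]` become `[1; 0]`, `[0; 1]`, `[0; 0]` modulo `2`. A real half
  -- period contributes no exponential factor.
  have hy : (1 / 2 : ℂ) = (((0 : ℝ) : ℂ) * τ + (1 : ℝ)) / 2 := by push_cast; ring
  have hy' : -(1 / 2 : ℂ) = (((0 : ℝ) : ℂ) * τ + (-1 : ℝ)) / 2 := by push_cast; ring
  have t1 := thetaChar_half ε ε' 0 1 τ
  have t2 := thetaChar_half ε ε' 0 (-1) τ
  have t3 := thetaConst_add_two_right_pow_three hk (ε' + -1) τ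
  rw [neg_one_zpow_two_mul_add_one, show ε' + -1 + 2 = ε' + 1 by ring] at t3
  have g1 := thetaChar_half 1 1 0 1 τ
  have g2 := thetaChar_half 0 0 0 1 τ
  have g3 := thetaChar_half 0 1 0 1 τ
  have c1 := thetaConst_add_two_right 1 0 τ
  have c2 := thetaConst_add_two_right 0 0 τ
  rw [← hy] at t1 g1 g2 g3
  rw [← hy'] at t2
  norm_num at t1 t2 t3 g1 g2 g3 c1 c2
  norm_num at key
  rw [t1, t2, t3, g1, g2, g3, c1, c2] at key
  rw [t3]
  refine mul_left_cancel₀ (mul_ne_zero (thetaConst_zero_zero_ne_zero hτ)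
    (thetaConst_zero_one_ne_zero hτ)) ?_
  linear_combination (-1 / 2) * key

/-! ### The twelve identities of level six. -/

theorem mainTheorem4 (τ : ℂ) (hτ : 0 < τ.im) :
    -- the theta constants in the denominators do not vanish
    (thetaConst 0 (1 / 3) τ ≠ 0 ∧
      thetaConst 0 (2 / 3) τ ≠ 0 ∧
      thetaConst (1 / 3) 0 τ ≠ 0 ∧
      thetaConst (1 / 3) (2 / 3) τ ≠ 0 ∧
      thetaConst (1 / 3) (4 / 3) τ ≠ 0 ∧
      thetaConst (2 / 3) 0 τ ≠ 0 ∧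
      thetaConst (2 / 3) 1 τ ≠ 0 ∧
      thetaConst (2 / 3) (1 / 3) τ ≠ 0 ∧
      thetaConst (2 / 3) (5 / 3) τ ≠ 0 ∧
      thetaConst (2 / 3) (2 / 3) τ ≠ 0 ∧
      thetaConst (2 / 3) (4 / 3) τ ≠ 0 ∧
      thetaConst 1 (2 / 3) τ ≠ 0 ∧
      thetaConst 0 0 τ ≠ 0 ∧
      thetaConst 0 1 τ ≠ 0 ∧
      thetaConst 1 0 τ ≠ 0) ∧
    thetaDeriv 0 (1 / 3) τ =
      (1 / 3) * (thetaDeriv 1 1 τ * thetaConst 1 (1 / 3) τ ^ 3 /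
        (thetaConst 0 (1 / 3) τ ^ 2 * thetaConst 0 1 τ)) ∧
    thetaDeriv 0 (2 / 3) τ =
      (1 / 3) * (thetaDeriv 1 1 τ * thetaConst 1 (1 / 3) τ ^ 3 /
        (thetaConst 0 (2 / 3) τ ^ 2 * thetaConst 0 0 τ)) ∧
    thetaDeriv (1 / 3) 0 τ =
      -(1 / 3) * (thetaDeriv 1 1 τ * thetaConst (1 / 3) 1 τ ^ 3 /
        (thetaConst (1 / 3) 0 τ ^ 2 * thetaConst 1 0 τ)) ∧
    thetaDeriv (1 / 3) (2 / 3) τ =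
      -(1 / 3) * (thetaDeriv 1 1 τ * thetaConst (1 / 3) (5 / 3) τ ^ 3 /
        (thetaConst (1 / 3) (2 / 3) τ ^ 2 * thetaConst 1 0 τ)) ∧
    thetaDeriv (1 / 3) (4 / 3) τ =
      (1 / 3) * (thetaDeriv 1 1 τ * thetaConst (1 / 3) (1 / 3) τ ^ 3 /
        (thetaConst (1 / 3) (4 / 3) τ ^ 2 * thetaConst 1 0 τ)) ∧
    thetaDeriv (2 / 3) 0 τ =
      -(1 / 3) * (thetaDeriv 1 1 τ * thetaConst (1 / 3) 1 τ ^ 3 /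
        (thetaConst (2 / 3) 0 τ ^ 2 * thetaConst 0 0 τ)) ∧
    thetaDeriv (2 / 3) 1 τ =
      (1 / 3) * (thetaDeriv 1 1 τ * thetaConst (1 / 3) 1 τ ^ 3 /
        (thetaConst (2 / 3) 1 τ ^ 2 * thetaConst 0 1 τ)) ∧
    thetaDeriv (2 / 3) (1 / 3) τ =
      -(1 / 3) * (thetaDeriv 1 1 τ * thetaConst (1 / 3) (5 / 3) τ ^ 3 /
        (thetaConst (2 / 3) (1 / 3) τ ^ 2 * thetaConst 0 1 τ)) ∧
    thetaDeriv (2 / 3) (5 / 3) τ =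
      -(1 / 3) * (thetaDeriv 1 1 τ * thetaConst (1 / 3) (1 / 3) τ ^ 3 /
        (thetaConst (2 / 3) (5 / 3) τ ^ 2 * thetaConst 0 1 τ)) ∧
    thetaDeriv (2 / 3) (2 / 3) τ =
      (1 / 3) * (thetaDeriv 1 1 τ * thetaConst (1 / 3) (1 / 3) τ ^ 3 /
        (thetaConst (2 / 3) (2 / 3) τ ^ 2 * thetaConst 0 0 τ)) ∧
    thetaDeriv (2 / 3) (4 / 3) τ =
      (1 / 3) * (thetaDeriv 1 1 τ * thetaConst (1 / 3) (5 / 3) τ ^ 3 /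
        (thetaConst (2 / 3) (4 / 3) τ ^ 2 * thetaConst 0 0 τ)) ∧
    thetaDeriv 1 (2 / 3) τ =
      (1 / 3) * (thetaDeriv 1 1 τ * thetaConst 1 (1 / 3) τ ^ 3 /
        (thetaConst 1 (2 / 3) τ ^ 2 * thetaConst 1 0 τ)) := by
 
  have nz : ∀ ε ε' : ℝ, (0 ≤ ε ∧ ε < 1 ∨ -1 < ε' ∧ ε' < 1) → thetaConst ε ε' τ ≠ 0 := by
    refine fun ε ε' h => thetaConst_ne_zero hτ fun m n hm hn => ?_
    rcases h with ⟨h0, h1⟩ | ⟨h0, h1⟩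
    · rw [hm] at h0 h1
      have a : 0 ≤ 2 * m + 1 := by exact_mod_cast h0
      have b : 2 * m + 1 < 1 := by exact_mod_cast h1
      omega
    · rw [hn] at h0 h1
      have a : -1 < 2 * n + 1 := by exact_mod_cast h0
      have b : 2 * n + 1 < 1 := by exact_mod_cast h1
      omega
  have z00 := thetaConst_zero_zero_ne_zero hτ
  have z01 := thetaConst_zero_one_ne_zero hτ
  have z10 := thetaConst_one_zero_ne_zero hτ
  have pos : ∀ {a d D t g : ℂ}, a ≠ 0 → g ≠ 0 → 3 * a ^ 2 * d * g = t * D →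
      d = (1 / 3) * (D * t / (a ^ 2 * g)) := by
    intro a d D t g ha hg h
    field_simp
    linear_combination h
  have neg : ∀ {a d D t g : ℂ}, a ≠ 0 → g ≠ 0 → 3 * a ^ 2 * d * g = -(t * D) →
      d = -(1 / 3) * (D * t / (a ^ 2 * g)) := by
    intro a d D t g ha hg h
    field_simp
    linear_combination h
  have h1 := nz 0 (1 / 3) (by norm_num)
  have h2 := nz 0 (2 / 3) (by norm_num)
  have h3 := nz (1 / 3) 0 (by norm_num)
  have h4 := nz (1 / 3) (2 / 3) (by norm_num)
  have h5 := nz (1 / 3) (4 / 3) (by norm_num)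
  have h6 := nz (2 / 3) 0 (by norm_num)
  have h7 := nz (2 / 3) 1 (by norm_num)
  have h8 := nz (2 / 3) (1 / 3) (by norm_num)
  have h9 := nz (2 / 3) (5 / 3) (by norm_num)
  have h10 := nz (2 / 3) (2 / 3) (by norm_num)
  have h11 := nz (2 / 3) (4 / 3) (by norm_num)
  have h12 := nz 1 (2 / 3) (by norm_num)
  -- The cubes produced by the three formulas are brought to the stated characteristics by `[ε; ε']
  -- ↦ [2 - ε; -ε']` and by shifts of `ε'` by `2`; the resulting signs account for the signs of the
  -- identities.
  have c1 : thetaConst 1 (5 / 3) τ ^ 3 = -thetaConst 1 (1 / 3) τ ^ 3 := by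
    have a := thetaConst_two_sub_neg 1 (1 / 3) τ
    have b := thetaConst_add_two_right_pow_three (ε := 1) (k := 3) (by norm_num) (-(1 / 3)) τ
    norm_num at a b ⊢
    rw [b, a]
  have c2 : thetaConst (1 / 3) (7 / 3) τ ^ 3 = -thetaConst (1 / 3) (1 / 3) τ ^ 3 := by
    have b := thetaConst_add_two_right_pow_three (ε := 1 / 3) (k := 1) (by norm_num) (1 / 3) τ
    norm_num at b ⊢
    exact b
  have c3 : thetaConst (5 / 3) 1 τ ^ 3 = -thetaConst (1 / 3) 1 τ ^ 3 := by
    have a := thetaConst_two_sub_neg (5 / 3) 1 τ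
    have b := thetaConst_add_two_right_pow_three (ε := 1 / 3) (k := 1) (by norm_num) (-1) τ
    norm_num at a b ⊢
    rw [b, a, neg_neg]
  have c4 : thetaConst (5 / 3) (1 / 3) τ ^ 3 = -thetaConst (1 / 3) (5 / 3) τ ^ 3 := by
    have a := thetaConst_two_sub_neg (5 / 3) (1 / 3) τ
    have b := thetaConst_add_two_right_pow_three (ε := 1 / 3) (k := 1) (by norm_num) (-(1 / 3)) τ
    norm_num at a b ⊢
    rw [b, a, neg_neg]
  have c5 : thetaConst (5 / 3) (5 / 3) τ ^ 3 = -thetaConst (1 / 3) (1 / 3) τ ^ 3 := by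
    have a := thetaConst_two_sub_neg (5 / 3) (5 / 3) τ
    have b := thetaConst_add_two_right_pow_three (ε := 1 / 3) (k := 1) (by norm_num) (-(5 / 3)) τ
    norm_num at a b ⊢
    rw [b, a, neg_neg]
  have c6 : thetaConst (5 / 3) (7 / 3) τ ^ 3 = thetaConst (1 / 3) (5 / 3) τ ^ 3 := by
    have a := thetaConst_add_two_right_pow_three (ε := 5 / 3) (k := 5) (by norm_num) (1 / 3) τ
    norm_num at a c4 ⊢
    rw [a, c4, neg_neg]
  refine ⟨⟨h1, h2, h3, h4, h5, h6, h7, h8, h9, h10, h11, h12, z00, z01, z10⟩,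
    ?_, ?_, ?_, ?_, ?_, ?_, ?_, ?_, ?_, ?_, ?_, ?_⟩
  · have h := thetaDeriv_formula_zero_one hτ (ε := 0) (ε' := 1 / 3) (k := 0) (l := 0)
      (by norm_num) (by norm_num)
    rw [show (0 : ℝ) + 1 = 1 by norm_num] at h
    exact pos h1 z01 (by rw [h]; norm_num)
  · have h := thetaDeriv_formula_zero_zero hτ (ε := 0) (ε' := 2 / 3) (k := 0) (l := 1)
      (by norm_num) (by norm_num)
    rw [show (0 : ℝ) + 1 = 1 by norm_num, show (2 / 3 : ℝ) + 1 = 5 / 3 by norm_num, c1] at h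
    exact pos h2 z00 (by rw [h]; norm_num)
  · have h := thetaDeriv_formula_one_zero hτ (ε := 1 / 3) (ε' := 0) (k := 0) (l := 0)
      (by norm_num) (by norm_num)
    rw [show (0 : ℝ) + 1 = 1 by norm_num] at h
    exact neg h3 z10 (by rw [h])
  · have h := thetaDeriv_formula_one_zero hτ (ε := 1 / 3) (ε' := 2 / 3) (k := 0) (l := 1)
      (by norm_num) (by norm_num)
    rw [show (2 / 3 : ℝ) + 1 = 5 / 3 by norm_num] at h
    exact neg h4 z10 (by rw [h])
  · have h := thetaDeriv_formula_one_zero hτ (ε := 1 / 3) (ε' := 4 / 3) (k := 0) (l := 2)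
      (by norm_num) (by norm_num)
    rw [show (4 / 3 : ℝ) + 1 = 7 / 3 by norm_num, c2] at h
    exact pos h5 z10 (by rw [h]; ring)
  · have h := thetaDeriv_formula_zero_zero hτ (ε := 2 / 3) (ε' := 0) (k := 1) (l := 0)
      (by norm_num) (by norm_num)
    rw [show (0 : ℝ) + 1 = 1 by norm_num, show (2 / 3 : ℝ) + 1 = 5 / 3 by norm_num, c3] at h
    exact neg h6 z00 (by rw [h]; norm_num)
  · have h := thetaDeriv_formula_zero_one hτ (ε := 2 / 3) (ε' := 1) (k := 1) (l := 1)
      (by norm_num) (by norm_num)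
    rw [show (2 / 3 : ℝ) + 1 = 5 / 3 by norm_num, c3] at h
    exact pos h7 z01 (by rw [h]; norm_num)
  · have h := thetaDeriv_formula_zero_one hτ (ε := 2 / 3) (ε' := 1 / 3) (k := 1) (l := 0)
      (by norm_num) (by norm_num)
    rw [show (2 / 3 : ℝ) + 1 = 5 / 3 by norm_num, c4] at h
    exact neg h8 z01 (by rw [h]; norm_num)
  · have h := thetaDeriv_formula_zero_one hτ (ε := 2 / 3) (ε' := 5 / 3) (k := 1) (l := 2)
      (by norm_num) (by norm_num)
    rw [show (2 / 3 : ℝ) + 1 = 5 / 3 by norm_num, c5] at h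
    exact neg h9 z01 (by rw [h]; norm_num)
  · have h := thetaDeriv_formula_zero_zero hτ (ε := 2 / 3) (ε' := 2 / 3) (k := 1) (l := 1)
      (by norm_num) (by norm_num)
    rw [show (2 / 3 : ℝ) + 1 = 5 / 3 by norm_num, c5] at h
    exact pos h10 z00 (by rw [h]; norm_num)
  · have h := thetaDeriv_formula_zero_zero hτ (ε := 2 / 3) (ε' := 4 / 3) (k := 1) (l := 2)
      (by norm_num) (by norm_num)
    rw [show (2 / 3 : ℝ) + 1 = 5 / 3 by norm_num, show (4 / 3 : ℝ) + 1 = 7 / 3 by norm_num, c6] at h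
    exact pos h11 z00 (by rw [h]; norm_num)
  · have h := thetaDeriv_formula_one_zero hτ (ε := 1) (ε' := 2 / 3) (k := 1) (l := 1)
      (by norm_num) (by norm_num)
    rw [show (2 / 3 : ℝ) + 1 = 5 / 3 by norm_num, c1] at h
    exact pos h12 z10 (by rw [h]; ring)
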